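/- Let $G$ be a finitely generated torsion-free nilpotent group with centre $Z(G)$, let $H\le G$ be a subgroup of finite index $m$, and let $f:H\to G$ be a homomorphism. A subgroup $K\le G$ is called $f$-invariant if $K\le H$ and $f(K)\le K$, and $f$ is called strongly simple if the trivial subgroup is the only $f$-invariant subgroup of $G$ (the same terminology is used for homomorphisms from a subgroup of $G/Z(G)$ to $G/Z(G)$). Suppose that $f$ is strongly simple. Then $f(H\cap Z(G))\le Z(G)$, so that $f$ induces a well-defined homomorphism $$\overline f:\ HZ(G)/Z(G)\to G/Z(G),\qquad Z(G)h\mapsto Z(G)f(h)\quad(h\in H),$$ and $\overline f$ is again strongly simple. Furthermore, the nilpotency class of $G$ is at most $l(m)$, the number of prime divisors of $m$ counted with multiplicity (with $l(1)=0$). -/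

import Mathlib

/-- For a homomorphism `f : H → G` on a subgroup `H ≤ G`, a subgroup `K` of `G` is
semi-invariant when `f (K ∩ H) ≤ K`. -/
def SemiInvariant {G : Type*} [Group G] {H : Subgroup G} (f : H →* G) (K : Subgroup G) : Prop :=
  (K.subgroupOf H).map f ≤ K

/-- A subgroup `K` of `G` is `f`-invariant when `K ≤ H` and `f K ≤ K`. -/
def FInvariant {G : Type*} [Group G] {H : Subgroup G} (f : H →* G) (K : Subgroup G) : Prop :=
  K ≤ H ∧ (K.subgroupOf H).map f ≤ K

/-- `f : H → G` is strongly simple when its only invariant subgroup is the trivial one. -/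
def StronglySimple {G : Type*} [Group G] {H : Subgroup G} (f : H →* G) : Prop :=
  ∀ K : Subgroup G, FInvariant f K → K = ⊥

/-- The subgroup `HN/N` of `G/N`, as the image of `HN` under `G → G/N`. -/
def quotientDomain {G : Type*} [Group G] (H N : Subgroup G) [N.Normal] : Subgroup (G ⧸ N) :=
  (H ⊔ N).map (QuotientGroup.mk' N)

/-- The subgroup `HN/N` consists of the cosets of the elements of `H`. -/
theorem quotientDomain_eq {G : Type*} [Group G] (H N : Subgroup G) [N.Normal] :
    quotientDomain H N = H.map (QuotientGroup.mk' N) := by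
  rw [quotientDomain, Subgroup.map_sup]
  simp

/-- The homomorphism `H → HN/N`, `h ↦ Nh`. -/
def toQuotientDomain {G : Type*} [Group G] (H N : Subgroup G) [N.Normal] :
    H →* quotientDomain H N :=
  ((QuotientGroup.mk' N).comp H.subtype).codRestrict (quotientDomain H N) fun h =>
    Subgroup.mem_map_of_mem _ ((le_sup_left : H ≤ H ⊔ N) h.2)

theorem toQuotientDomain_surjective {G : Type*} [Group G] (H N : Subgroup G) [N.Normal] :
    Function.Surjective (toQuotientDomain H N) := by
  rintro ⟨x, hx⟩
  have hx' := hx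
  rw [quotientDomain_eq] at hx'
  obtain ⟨h, hh, rfl⟩ := hx'
  exact ⟨⟨h, hh⟩, rfl⟩

/-- For a normal semi-invariant subgroup `N`, the induced map `HN/N → G/N`, `Nh ↦ N (f h)`. -/
noncomputable def quotientHom {G : Type*} [Group G] {H : Subgroup G} (f : H →* G)
    (N : Subgroup G) [N.Normal] (hN : SemiInvariant f N) :
    quotientDomain H N →* G ⧸ N :=
  (toQuotientDomain H N).liftOfSurjective (toQuotientDomain_surjective H N)
    ⟨(QuotientGroup.mk' N).comp f, fun h hh => by
      have h1 : ((h : G) : G ⧸ N) = 1 := congrArg Subtype.val (MonoidHom.mem_ker.1 hh)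
      have h2 : h ∈ N.subgroupOf H :=
        Subgroup.mem_subgroupOf.2 ((QuotientGroup.eq_one_iff _).1 h1)
      exact MonoidHom.mem_ker.2
        ((QuotientGroup.eq_one_iff _).2 (hN (Subgroup.mem_map_of_mem f h2)))⟩

/-- The induced map sends `Nh` to `N (f h)` for every `h` in `H`. -/
theorem quotientHom_apply {G : Type*} [Group G] {H : Subgroup G} (f : H →* G)
    (N : Subgroup G) [N.Normal] (hN : SemiInvariant f N) (h : H) :
    quotientHom f N hN (toQuotientDomain H N h) = ((f h : G) : G ⧸ N) :=
  MonoidHom.liftOfRightInverse_comp_apply _ _ _ _ h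

/-!
# Strongly simple virtual endomorphisms of nilpotent groups

The kernel of `f` is `f`-invariant, so a strongly simple `f` is injective. A finitely generated
nilpotent group carries a Hirsch length on its subgroups (`HasSubgroupRank.of_isNilpotent`), and if
`f H` had infinite index, the iterates of `K ↦ f (K ∩ H)` would form an infinite chain of strictly
decreasing Hirsch length. Hence `f H` has finite index
(`HasSubgroupRank.index_range_ne_zero`). The image of an element of `H ∩ Z(G)` centralizes `f H`; in
a torsion-free nilpotent group an element that commutes with a positive power of `y` commutes with
`y`, so this image is central (`semiInvariant_center_of_injective`).

Let `K/Z(G)` be invariant under the induced map. Then `K = (K ∩ H) Z(G)`, so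
`[K, K] = [K ∩ H, K ∩ H]` is `f`-invariant, hence trivial, and `K` is abelian. If `K ≠ Z(G)`, the
induced endomorphism of the free abelian group `K/Z(G)` is killed by a monic integer polynomial `p`.
The rational extension `φ` of `f` to `K ⊗ ℚ` is such that `p(φ)` maps `K ⊗ ℚ` into the proper
subspace `Z(G) ⊗ ℚ`, so some `u ≠ 0` in `K` satisfies `p(φ) u = 0`. As `p` is monic and integral, the
span of `u, φ u, …, φⁿ⁻¹ u` is `φ`-stable, and a multiple of it lies in `H`: this is a nontrivial
`f`-invariant subgroup, a contradiction. To avoid the rational extension, the proof uses the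
endomorphism `g = e φ`, that is `g k = f (k ^ e)`, and rescales the roots of `p` by `e`.

For the bound on the class, `[G : H] = [G : H Z(G)] [H Z(G) : H]`, and the second factor is not `1`,
since otherwise `Z(G) ≤ H` would be a nontrivial `f`-invariant subgroup. So passing to `G/Z(G)`
lowers the class by one and the number of prime divisors of the index by at least one.
-/

open scoped commutatorElement

/-! ### Subgroups of finitely generated nilpotent groups -/

theorem Subgroup.FG.of_map_of_inf_ker {G Q : Type*} [Group G] [Group Q] (φ : G →* Q)
    {K : Subgroup G} (h1 : (K.map φ).FG) (h2 : (K ⊓ φ.ker).FG) : K.FG := by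
  obtain ⟨T, hT⟩ := h1
  have hTK : (T : Set Q) ⊆ φ '' K := by
    rw [← Subgroup.coe_map, ← hT]
    exact Subgroup.subset_closure
  classical
  obtain ⟨S, hS, rfl⟩ := Finset.subset_set_image_iff.1 hTK
  have hle : Subgroup.closure (S : Set G) ≤ K := (Subgroup.closure_le K).2 hS
  have hK : K = Subgroup.closure (S : Set G) ⊔ (K ⊓ φ.ker) := by
    refine le_antisymm (fun k hk => ?_) (sup_le hle inf_le_left)
    have hk' : φ k ∈ (Subgroup.closure (S : Set G)).map φ := by
      rw [MonoidHom.map_closure, ← Finset.coe_image, hT]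
      exact Subgroup.mem_map_of_mem φ hk
    obtain ⟨s, hs, hsk⟩ := hk'
    have h3 : s⁻¹ * k ∈ K ⊓ φ.ker :=
      ⟨K.mul_mem (K.inv_mem (hle hs)) hk, by simp [hsk]⟩
    have := Subgroup.mul_mem_sup hs h3
    rwa [mul_inv_cancel_left] at this
  rw [hK]
  exact Subgroup.FG.sup ⟨S, rfl⟩ h2

/-- Finite index can be tested on the kernel and on the range of a homomorphism: products of
representatives for the two parts represent all cosets of `K`. -/
theorem Subgroup.index_ne_zero_of_relIndex_of_index_map {G Q : Type*} [Group G] [Group Q]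
    (φ : G →* Q) {K : Subgroup G} (h1 : K.relIndex φ.ker ≠ 0)
    (h2 : (K.map φ).relIndex φ.range ≠ 0) : K.index ≠ 0 := by
  have h3 : (K ⊔ φ.ker).index ≠ 0 := by
    rwa [← Subgroup.comap_map_eq, Subgroup.index_comap]
  have : Finite (G ⧸ (K ⊔ φ.ker)) := (Subgroup.index_ne_zero_iff_finite).1 h3
  have : Finite (φ.ker ⧸ K.subgroupOf φ.ker) := (Subgroup.index_ne_zero_iff_finite).1 h1
  rw [Subgroup.index_ne_zero_iff_finite]
  refine Finite.of_surjective
    (fun p : (G ⧸ (K ⊔ φ.ker)) × (φ.ker ⧸ K.subgroupOf φ.ker) =>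
      ((p.1.out * (p.2.out : G) : G) : G ⧸ K)) fun x => ?_
  induction x using QuotientGroup.induction_on with | H x => ?_
  have hx : ((x : G ⧸ (K ⊔ φ.ker)).out)⁻¹ * x ∈ φ.ker ⊔ K := by
    rw [sup_comm]
    exact QuotientGroup.eq.1 (QuotientGroup.out_eq' _)
  obtain ⟨n, hn, k, hk, hnk⟩ := Subgroup.mem_sup_of_normal_left.1 hx
  refine ⟨((x : G ⧸ (K ⊔ φ.ker)), ((⟨n, hn⟩ : φ.ker) : φ.ker ⧸ K.subgroupOf φ.ker)), ?_⟩
  have hb : (((⟨n, hn⟩ : φ.ker) : φ.ker ⧸ K.subgroupOf φ.ker).out)⁻¹ * (⟨n, hn⟩ : φ.ker) ∈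
      K.subgroupOf φ.ker := QuotientGroup.eq.1 (QuotientGroup.out_eq' _)
  rw [Subgroup.mem_subgroupOf] at hb
  push_cast at hb
  refine QuotientGroup.eq.2 ?_
  have := K.mul_mem hb hk
  rw [mul_assoc, hnk] at this
  simpa [mul_assoc] using this

/-- A group has this property when all its subgroups are finitely generated and they carry a
monotone `ℕ`-valued rank that is strictly smaller on subgroups of infinite index. For a finitely
generated nilpotent group the rank is the Hirsch length. -/
structure HasSubgroupRank (G : Type*) [Group G] : Prop where
  fg : ∀ K : Subgroup G, K.FG
  exists_rank : ∃ d : Subgroup G → ℕ, Monotone d ∧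
    ∀ K L : Subgroup G, K ≤ L → K.relIndex L = 0 → d K < d L

/-- The rank of a subgroup is its `finrank` over `ℤ`. -/
theorem HasSubgroupRank.of_commGroup (A : Type*) [CommGroup A] [Group.FG A] :
    HasSubgroupRank A := by
  have : Module.Finite ℤ (Additive A) := Module.Finite.iff_addGroup_fg.2 inferInstance
  refine ⟨fun K => ?_, fun K => Module.finrank ℤ (AddSubgroup.toIntSubmodule K.toAddSubgroup),
    fun K L h => ?_, fun K L h hi => ?_⟩
  · rw [Subgroup.fg_iff_add_fg, ← AddSubgroup.toIntSubmodule_toAddSubgroup K.toAddSubgroup,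
      ← Submodule.fg_iff_addSubgroup_fg]
    exact IsNoetherian.noetherian _
  · exact Submodule.finrank_mono (fun x hx => h hx)
  · set P := AddSubgroup.toIntSubmodule K.toAddSubgroup
    set Q := AddSubgroup.toIntSubmodule L.toAddSubgroup
    have hPQ : P ≤ Q := fun x hx => h hx
    have h1 := (P.submoduleOf Q).finrank_quotient_add_finrank
    rw [(Submodule.submoduleOfEquivOfLe hPQ).finrank_eq] at h1
    refine lt_of_le_of_ne (Submodule.finrank_mono hPQ) fun heq => ?_
    have h2 : Module.finrank ℤ (Q ⧸ P.submoduleOf Q) = 0 := by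
      change Module.finrank ℤ P = Module.finrank ℤ Q at heq
      omega
    have h3 : Finite (Q ⧸ P.submoduleOf Q) :=
      Module.finite_of_fg_torsion _ (Module.finrank_eq_zero_iff_isTorsion.1 h2)
    have h4 : (P.submoduleOf Q).toAddSubgroup.index ≠ 0 :=
      AddSubgroup.index_ne_zero_iff_finite.2 h3
    apply h4
    have h5 : (P.submoduleOf Q).toAddSubgroup = (K.toAddSubgroup).addSubgroupOf L.toAddSubgroup := by
      ext x
      rfl
    rw [h5]
    change K.toAddSubgroup.relIndex L.toAddSubgroup = 0
    rw [Subgroup.relIndex_toAddSubgroup, hi]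

/-- The rank of `K` is the sum of those of `K ∩ N` and `KN/N`. -/
theorem HasSubgroupRank.of_extension {G : Type*} [Group G] (N : Subgroup G) [N.Normal]
    (hN : HasSubgroupRank N) (hQ : HasSubgroupRank (G ⧸ N)) : HasSubgroupRank G := by
  obtain ⟨dN, mN, sN⟩ := hN.exists_rank
  obtain ⟨dQ, mQ, sQ⟩ := hQ.exists_rank
  refine ⟨fun K => ?_, fun K => dN (K.subgroupOf N) + dQ (K.map (QuotientGroup.mk' N)),
    fun K L h => ?_, fun K L h hi => ?_⟩
  · refine Subgroup.FG.of_map_of_inf_ker (QuotientGroup.mk' N) (hQ.fg _) ?_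
    rw [QuotientGroup.ker_mk', ← Subgroup.subgroupOf_map_subtype]
    have : Group.FG (K.subgroupOf N) := (Group.fg_iff_subgroup_fg _).2 (hN.fg _)
    rw [← MonoidHom.domRestrict_range]
    exact (Group.fg_iff_subgroup_fg _).1 inferInstance
  · exact add_le_add (mN (Subgroup.comap_mono h)) (mQ (Subgroup.map_mono h))
  · by_cases h1 : (K.subgroupOf N).relIndex (L.subgroupOf N) = 0
    · exact add_lt_add_of_lt_of_le (sN _ _ (Subgroup.comap_mono h) h1) (mQ (Subgroup.map_mono h))
    by_cases h2 : (K.map (QuotientGroup.mk' N)).relIndex (L.map (QuotientGroup.mk' N)) = 0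
    · exact add_lt_add_of_le_of_lt (mN (Subgroup.comap_mono h)) (sQ _ _ (Subgroup.map_mono h) h2)
    refine absurd hi (Subgroup.index_ne_zero_of_relIndex_of_index_map
      ((QuotientGroup.mk' N).comp L.subtype) ?_ ?_)
    · have h3 : ((QuotientGroup.mk' N).comp L.subtype).ker = N.subgroupOf L := by
        rw [← MonoidHom.comap_ker, QuotientGroup.ker_mk']
        rfl
      rw [h3, ← Subgroup.relIndex_map_map_of_injective _ _ L.subtype_injective,
        Subgroup.subgroupOf_map_subtype, Subgroup.subgroupOf_map_subtype, inf_of_le_left h]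
      rw [← Subgroup.relIndex_map_map_of_injective _ _ N.subtype_injective,
        Subgroup.subgroupOf_map_subtype, Subgroup.subgroupOf_map_subtype] at h1
      rw [← Subgroup.inf_relIndex_right, inf_comm N L]
      rwa [← Subgroup.inf_relIndex_right, inf_assoc, inf_comm N, inf_assoc, inf_idem,
        ← inf_assoc, inf_of_le_left h, ← inf_of_le_left h, inf_assoc] at h1
    · rw [← Subgroup.map_map, Subgroup.subgroupOf_map_subtype, inf_of_le_left h,
        MonoidHom.range_comp, Subgroup.range_subtype]
      exact h2

/-- If `N = [Y, G]` is central, it is generated by the commutators of representatives of generators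
of `Y/N` with generators of `G`. -/
theorem Subgroup.FG.commutator_top_of_le_center {G : Type*} [Group G] [Group.FG G]
    {Y N : Subgroup G} [N.Normal] (hN : ⁅Y, (⊤ : Subgroup G)⁆ = N) (hc : N ≤ Subgroup.center G)
    (hY : (Y.map (QuotientGroup.mk' N)).FG) : N.FG := by
  classical
  obtain ⟨T, hT⟩ := hY
  have hTY : (T : Set (G ⧸ N)) ⊆ QuotientGroup.mk' N '' Y := by
    rw [← Subgroup.coe_map, ← hT]
    exact Subgroup.subset_closure
  obtain ⟨S, hS, rfl⟩ := Finset.subset_set_image_iff.1 hTY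
  obtain ⟨R, hR⟩ := Group.fg_def.1 (inferInstance : Group.FG G)
  set C : Finset G := (S ×ˢ R).image fun p => ⁅p.1, p.2⁆
  set M := Subgroup.closure (C : Set G) with hM
  have hMN : M ≤ N := by
    rw [hM, Subgroup.closure_le]
    intro c hcC
    obtain ⟨⟨s, r⟩, hp, rfl⟩ := Finset.mem_image.1 hcC
    rw [← hN]
    exact Subgroup.commutator_mem_commutator (hS (Finset.mem_product.1 hp).1) trivial
  have hMnormal : M.Normal := ⟨fun n hn g => by
    rw [Subgroup.mem_center_iff.1 (hc (hMN hn)) g, mul_inv_cancel_right]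
    exact hn⟩
  have hNM : N ≤ M := by
    rw [← hN, Subgroup.commutator_le]
    -- It suffices that the image of `Y` in `G/M` is central.
    suffices h : Y ≤ (Subgroup.center (G ⧸ M)).comap (QuotientGroup.mk' M) by
      intro y hy g _
      have h1 := Subgroup.mem_center_iff.1 (h hy) (g : G ⧸ M)
      rw [← QuotientGroup.eq_one_iff]
      exact commutatorElement_eq_one_iff_mul_comm.2 h1.symm
    have hN' : N ≤ (Subgroup.center (G ⧸ M)).comap (QuotientGroup.mk' M) := fun n hn => by
      refine Subgroup.mem_comap.2 (Subgroup.mem_center_iff.2 fun q => ?_)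
      induction q using QuotientGroup.induction_on with | H g => ?_
      exact congrArg (QuotientGroup.mk (s := M)) (Subgroup.mem_center_iff.1 (hc hn) g)
    have hS' : Subgroup.closure (S : Set G) ≤
        (Subgroup.center (G ⧸ M)).comap (QuotientGroup.mk' M) := by
      rw [Subgroup.closure_le]
      intro s hs
      refine Subgroup.mem_comap.2 (Subgroup.mem_center_iff.2 fun q => ?_)
      induction q using QuotientGroup.induction_on with | H g => ?_
      have hg : (⊤ : Subgroup G) ≤
          (Subgroup.centralizer {(s : G ⧸ M)}).comap (QuotientGroup.mk' M) := by
        rw [← hR, Subgroup.closure_le]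
        intro r hr
        refine Subgroup.mem_comap.2 (Subgroup.mem_centralizer_singleton_iff.2 ?_)
        have h2 : ⁅s, r⁆ ∈ M := Subgroup.subset_closure
          (Finset.mem_image.2 ⟨(s, r), Finset.mem_product.2 ⟨hs, hr⟩, rfl⟩)
        rw [← QuotientGroup.eq_one_iff] at h2
        exact (commutatorElement_eq_one_iff_mul_comm.1 h2).symm
      exact Subgroup.mem_centralizer_singleton_iff.1 (hg (Subgroup.mem_top g))
    have hY' : Y ≤ Subgroup.closure (S : Set G) ⊔ N := by
      have h3 : Y ≤ (Y.map (QuotientGroup.mk' N)).comap (QuotientGroup.mk' N) :=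
        Subgroup.le_comap_map _ _
      rwa [← hT, Finset.coe_image, ← MonoidHom.map_closure, Subgroup.comap_map_eq,
        QuotientGroup.ker_mk'] at h3
    exact hY'.trans (sup_le hS' hN')
  rw [le_antisymm hNM hMN]
  exact ⟨C, rfl⟩

theorem HasSubgroupRank.of_lowerCentralSeries_eq_bot (n : ℕ) : ∀ (G : Type*) [Group G]
    [Group.FG G], (⊤ : Subgroup G).lowerCentralSeries (n + 1) = ⊥ → HasSubgroupRank G := by
  induction n with
  | zero =>
    intro G _ _ h
    let _ : CommGroup G := { (inferInstance : Group G) with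
      mul_comm := fun a b => by
        have h1 : ⁅a, b⁆ ∈ (⊤ : Subgroup G).lowerCentralSeries 1 :=
          Subgroup.commutator_mem_commutator (Subgroup.mem_top a) (Subgroup.mem_top b)
        rw [h, Subgroup.mem_bot] at h1
        exact commutatorElement_eq_one_iff_mul_comm.1 h1 }
    exact HasSubgroupRank.of_commGroup G
  | succ n ih =>
    intro G _ _ h
    set N := (⊤ : Subgroup G).lowerCentralSeries (n + 1) with hN
    have hc : N ≤ Subgroup.center G := fun x hx => by
      refine Subgroup.mem_center_iff.2 fun g => ?_
      have h1 : ⁅x, g⁆ ∈ (⊤ : Subgroup G).lowerCentralSeries (n + 1 + 1) :=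
        Subgroup.commutator_mem_commutator hx (Subgroup.mem_top g)
      rw [h, Subgroup.mem_bot] at h1
      exact (commutatorElement_eq_one_iff_mul_comm.1 h1).symm
    have hQ : HasSubgroupRank (G ⧸ N) := by
      refine ih _ ?_
      rw [← Subgroup.map_top_of_surjective _ (QuotientGroup.mk'_surjective N),
        ← Subgroup.map_lowerCentralSeries, ← hN]
      simp
    have hNfg : N.FG :=
      Subgroup.FG.commutator_top_of_le_center (Y := (⊤ : Subgroup G).lowerCentralSeries n) rfl hc
        (hQ.fg _)
    refine HasSubgroupRank.of_extension N ?_ hQ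
    let _ : CommGroup N := { (inferInstance : Group N) with
      mul_comm := fun a b => Subtype.ext (Subgroup.mem_center_iff.1 (hc b.2) a) }
    have : Group.FG N := (Group.fg_iff_subgroup_fg N).2 hNfg
    exact HasSubgroupRank.of_commGroup N

theorem HasSubgroupRank.of_isNilpotent (G : Type*) [Group G] [Group.FG G] [Group.IsNilpotent G] :
    HasSubgroupRank G := by
  refine HasSubgroupRank.of_lowerCentralSeries_eq_bot (Group.nilpotencyClass G) G ?_
  exact Subgroup.lowerCentralSeries_eq_bot_iff_nilpotencyClass_le.2 (Nat.le_succ _)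

/-! ### Roots in torsion-free nilpotent groups -/

theorem commutatorElement_pow_left {G : Type*} [Group G] {x g : G}
    (h : ⁅x, g⁆ ∈ Subgroup.center G) (n : ℕ) : ⁅x ^ n, g⁆ = ⁅x, g⁆ ^ n := by
  have hc : Commute ⁅x, g⁆ x := (Subgroup.mem_center_iff.1 h x).symm
  have h1 : g * x * g⁻¹ = ⁅x, g⁆⁻¹ * x := by
    rw [commutatorElement_def]
    group
  calc ⁅x ^ n, g⁆ = x ^ n * ((g * x * g⁻¹) ^ n)⁻¹ := by
        rw [commutatorElement_def, conj_pow]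
        group
    _ = ⁅x, g⁆ ^ n := by
        rw [h1, hc.inv_left.mul_pow, mul_inv_rev, mul_inv_cancel_left, inv_pow, inv_inv]

/-- In a torsion-free group the factors of the upper central series are torsion-free. -/
theorem Subgroup.mem_upperCentralSeries_of_pow_mem {G : Type*} [Group G]
    (htf : ∀ g : G, IsOfFinOrder g → g = 1) {n : ℕ} (hn : 0 < n) (i : ℕ) :
    ∀ x ∈ Subgroup.upperCentralSeries G (i + 1), x ^ n ∈ Subgroup.upperCentralSeries G i →
      x ∈ Subgroup.upperCentralSeries G i := by
  induction i with
  | zero =>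
    intro x _ h
    rw [Subgroup.upperCentralSeries_zero, Subgroup.mem_bot] at h ⊢
    exact htf x (isOfFinOrder_iff_pow_eq_one.2 ⟨n, hn, h⟩)
  | succ i ih =>
    intro x hx h
    refine Subgroup.mem_upperCentralSeries_succ_iff.2 fun g => ih _ (hx g) ?_
    rw [← QuotientGroup.eq_one_iff]
    have h1 : ⁅(x : G ⧸ Subgroup.upperCentralSeries G i),
        (g : G ⧸ Subgroup.upperCentralSeries G i)⁆ ∈ Subgroup.center _ := by
      refine Subgroup.mem_center_iff.2 fun q => ?_
      induction q using QuotientGroup.induction_on with | H y => ?_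
      have h2 := Subgroup.mem_upperCentralSeries_succ_iff.1 (hx g) y
      rw [← QuotientGroup.eq_one_iff] at h2
      exact (commutatorElement_eq_one_iff_mul_comm.1 h2).symm
    have h3 := Subgroup.mem_upperCentralSeries_succ_iff.1 h g
    rw [← QuotientGroup.eq_one_iff] at h3
    exact (commutatorElement_pow_left h1 n).symm.trans h3

/-- Since `x ^ n` is central, torsion-freeness of the upper central factors lets `x` descend from the
top of the series to the centre. -/
theorem Subgroup.mem_center_of_pow_mem_center {G : Type*} [Group G] [Group.IsNilpotent G]
    (htf : ∀ g : G, IsOfFinOrder g → g = 1) {n : ℕ} (hn : 0 < n) {x : G}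
    (hx : x ^ n ∈ Subgroup.center G) : x ∈ Subgroup.center G := by
  rw [← Subgroup.upperCentralSeries_one] at hx ⊢
  have key : ∀ j, x ∈ Subgroup.upperCentralSeries G (j + 1) →
      x ∈ Subgroup.upperCentralSeries G 1 := by
    intro j
    induction j with
    | zero => exact id
    | succ j ih =>
      exact fun h => ih (Subgroup.mem_upperCentralSeries_of_pow_mem htf hn _ _ h
        (Subgroup.upperCentralSeries_mono G (Nat.le_add_left 1 j) hx))
  refine key (Group.nilpotencyClass G) (Subgroup.upperCentralSeries_mono G (Nat.le_succ _) ?_)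
  rw [Subgroup.upperCentralSeries_nilpotencyClass]
  exact Subgroup.mem_top x

theorem isOfFinOrder_quotient_center_eq_one {G : Type*} [Group G] [Group.IsNilpotent G]
    (htf : ∀ g : G, IsOfFinOrder g → g = 1) :
    ∀ g : G ⧸ Subgroup.center G, IsOfFinOrder g → g = 1 := by
  intro q hq
  induction q using QuotientGroup.induction_on with | H g => ?_
  obtain ⟨n, hn, h⟩ := isOfFinOrder_iff_pow_eq_one.1 hq
  rw [← QuotientGroup.mk_pow, QuotientGroup.eq_one_iff] at h
  exact (QuotientGroup.eq_one_iff g).2 (Subgroup.mem_center_of_pow_mem_center htf hn h)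

/-- By induction on the class, `x` and `y` commute modulo the centre, so `[x, y]` is central and
`[x, y] ^ n = [x ^ n, y] = 1`. -/
theorem Commute.of_pow_left_of_torsionFree (G : Type*) [Group G] [Group.IsNilpotent G]
    (htf : ∀ g : G, IsOfFinOrder g → g = 1) {n : ℕ} (hn : 0 < n) :
    ∀ x y : G, Commute (x ^ n) y → Commute x y := by
  revert htf
  refine Group.nilpotent_center_quotient_ind (P := fun G _ _ =>
    (∀ g : G, IsOfFinOrder g → g = 1) → ∀ x y : G, Commute (x ^ n) y → Commute x y) G ?_ ?_
  · exact fun G _ _ _ x y _ => Subsingleton.elim _ _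
  · intro G _ _ ih htf x y h
    have h1 := ih (isOfFinOrder_quotient_center_eq_one htf) (x : G ⧸ Subgroup.center G)
      (y : G ⧸ Subgroup.center G)
      (h.map (QuotientGroup.mk' (Subgroup.center G)))
    have h2 : ⁅x, y⁆ ∈ Subgroup.center G :=
      (QuotientGroup.eq_one_iff _).1 (commutatorElement_eq_one_iff_commute.2 h1)
    refine commutatorElement_eq_one_iff_commute.1 (htf _ (isOfFinOrder_iff_pow_eq_one.2 ⟨n, hn, ?_⟩))
    rw [← commutatorElement_pow_left h2, commutatorElement_eq_one_iff_commute.2 h]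

/-! ### Injective virtual endomorphisms -/

/-- The kernel of `f` is `f`-invariant. -/
theorem StronglySimple.injective {G : Type*} [Group G] {H : Subgroup G} {f : H →* G}
    (hf : StronglySimple f) : Function.Injective f := by
  have h1 : (f.ker.map H.subtype).subgroupOf H = f.ker :=
    Subgroup.comap_map_eq_self_of_injective H.subtype_injective _
  have h : f.ker.map H.subtype = ⊥ := by
    refine hf _ ⟨Subgroup.map_subtype_le _, ?_⟩
    rw [h1, (Subgroup.map_eq_bot_iff _).2 le_rfl]
    exact bot_le
  rw [← MonoidHom.ker_eq_bot_iff]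
  exact (Subgroup.map_eq_bot_iff_of_injective _ H.subtype_injective).1 h

/-- If the image `f H` had infinite index, the iterates of `K ↦ f (K ∩ H)` at `⊤` would form an
infinite chain of subgroups, each of infinite index in the preceding one. -/
theorem HasSubgroupRank.index_range_ne_zero {G : Type*} [Group G] (hG : HasSubgroupRank G)
    {H : Subgroup G} (hH : H.index ≠ 0) {f : H →* G} (hf : Function.Injective f) :
    f.range.index ≠ 0 := by
  intro h0
  obtain ⟨d, -, hd⟩ := hG.exists_rank
  let F : Subgroup G → Subgroup G := fun K => (K.subgroupOf H).map f
  have hF : Monotone F := fun K L h => Subgroup.map_mono (Subgroup.comap_mono h)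
  have hF0 : ∀ K L, K ≤ L → K.relIndex L = 0 → (F K).relIndex (F L) = 0 := by
    intro K L hKL h
    by_contra h1
    rw [Subgroup.relIndex_map_map_of_injective _ _ hf,
      ← Subgroup.relIndex_map_map_of_injective _ _ H.subtype_injective,
      Subgroup.subgroupOf_map_subtype, Subgroup.subgroupOf_map_subtype] at h1
    have h2 : (L ⊓ H).relIndex L ≠ 0 := by
      rw [Subgroup.inf_relIndex_left]
      exact fun h3 => hH (Subgroup.index_eq_zero_of_relIndex_eq_zero h3)
    have h3 := mul_ne_zero h1 h2
    rw [Subgroup.relIndex_mul_relIndex _ _ _ (inf_le_inf_right H hKL) inf_le_left] at h3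
    exact h3 (Subgroup.relIndex_eq_zero_of_le_left inf_le_left h)
  have hchain : ∀ n, F^[n + 1] ⊤ ≤ F^[n] ⊤ ∧ (F^[n + 1] ⊤).relIndex (F^[n] ⊤) = 0 := by
    intro n
    induction n with
    | zero =>
      refine ⟨le_top, ?_⟩
      have h1 : F ⊤ = f.range := by
        simp only [F]
        rw [Subgroup.top_subgroupOf, MonoidHom.range_eq_map]
      simpa [h1, Subgroup.relIndex_top_right] using h0
    | succ n ih =>
      rw [Function.iterate_succ_apply' F (n + 1), Function.iterate_succ_apply' F n]
      rw [Function.iterate_succ_apply' F n] at ih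
      exact ⟨hF ih.1, hF0 _ _ ih.1 ih.2⟩
  have hanti : StrictAnti fun n => d (F^[n] ⊤) :=
    strictAnti_nat_of_succ_lt fun n => hd _ _ (hchain n).1 (hchain n).2
  exact not_strictAnti_of_wellFoundedLT _ hanti

/-- A central element of `H` is mapped to the centralizer of the finite index subgroup `f H`, which
is the centre of `G` because `G` is torsion-free nilpotent. -/
theorem semiInvariant_center_of_injective {G : Type*} [Group G] [Group.FG G] [Group.IsNilpotent G]
    (htf : ∀ g : G, IsOfFinOrder g → g = 1) {H : Subgroup G} (hH : H.index ≠ 0) {f : H →* G}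
    (hf : Function.Injective f) : SemiInvariant f (Subgroup.center G) := by
  have hidx := (HasSubgroupRank.of_isNilpotent G).index_range_ne_zero hH hf
  rintro _ ⟨z, hz, rfl⟩
  refine Subgroup.mem_center_iff.2 fun y => ?_
  obtain ⟨n, hn, -, h, hh⟩ := Subgroup.exists_pow_mem_of_index_ne_zero hidx y
  refine Commute.of_pow_left_of_torsionFree G htf hn y (f z) ?_
  rw [← hh]
  have h1 : Commute h z := Subtype.ext (Subgroup.mem_center_iff.1 hz h)
  exact h1.map f

/-! ### Invariant lattices in abelian groups -/

/-- A monic integer polynomial `p` with `p(fb) = 0` on `Q` makes `p.scaleRoots e` at `g` map `K` into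
the kernel of `π`, which has smaller rank than `K`; hence it has a nonzero kernel. -/
theorem exists_ne_zero_aeval_scaleRoots_apply_eq_zero {K Q : Type*} [AddCommGroup K]
    [AddCommGroup Q] [Module.Finite ℤ K] {π : K →ₗ[ℤ] Q} (hπ : Function.Surjective π)
    (hQ : ¬ Module.IsTorsion ℤ Q) {g : Module.End ℤ K} {fb : Module.End ℤ Q} {e : ℤ}
    (h : ∀ k, π (g k) = e • fb (π k)) :
    ∃ p : Polynomial ℤ, p.Monic ∧ ∃ u, u ≠ 0 ∧ Polynomial.aeval g (p.scaleRoots e) u = 0 := by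
  have : Module.Finite ℤ Q := Module.Finite.of_surjective π hπ
  obtain ⟨p, hp, hp0⟩ := LinearMap.exists_monic_and_aeval_eq_zero ℤ fb
  refine ⟨p, hp, ?_⟩
  have hcomm : ∀ q : Polynomial ℤ, ∀ k,
      π (Polynomial.aeval g q k) = Polynomial.aeval (algebraMap ℤ _ e * fb) q (π k) := by
    intro q
    induction q using Polynomial.induction_on' with
    | add a b ha hb => intro k; simp [ha, hb]
    | monomial n a =>
      intro k
      rw [Polynomial.aeval_monomial, Polynomial.aeval_monomial, Module.End.mul_apply,
        Module.End.mul_apply, Module.algebraMap_end_apply, Module.algebraMap_end_apply, map_smul]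
      congr 1
      induction n with
      | zero => rfl
      | succ n ih =>
        rw [pow_succ', pow_succ', Module.End.mul_apply, Module.End.mul_apply, h, ih]
        rfl
  set P := Polynomial.aeval g (p.scaleRoots e) with hP
  have hPker : ∀ k, P k ∈ LinearMap.ker π := fun k => by
    rw [LinearMap.mem_ker, hP, hcomm, Polynomial.scaleRoots_aeval_eq_zero hp0,
      LinearMap.zero_apply]
  by_contra! hne
  have hinj : Function.Injective (P.codRestrict _ hPker) := by
    rw [← LinearMap.ker_eq_bot, LinearMap.ker_codRestrict, LinearMap.ker_eq_bot']
    intro u hu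
    by_contra hu0
    exact hne u hu0 hu
  have h1 := LinearMap.finrank_le_finrank_of_injective hinj
  have h2 := (LinearMap.ker π).finrank_quotient_add_finrank
  rw [(π.quotKerEquivOfSurjective hπ).finrank_eq] at h2
  exact hQ (Module.finrank_eq_zero_iff_isTorsion.1 (by omega))

/-- If `u` is killed by `p.scaleRoots e` at `g`, where `p` is monic of degree `n`, then the span of
the vectors `e ^ (n - i) g ^ i u` for `i < n` consists of multiples `e y` and is stable under
`e y ↦ g y`. -/
theorem exists_submodule_stable_under_smul_to_map {K : Type*} [AddCommGroup K] {e : ℤ}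
    (he : ∀ x : K, e • x = 0 → x = 0) {g : Module.End ℤ K} {p : Polynomial ℤ} (hp : p.Monic)
    {u : K} (hu : u ≠ 0) (h : Polynomial.aeval g (p.scaleRoots e) u = 0) :
    ∃ L : Submodule ℤ K, L ≠ ⊥ ∧ ∀ x ∈ L, ∃ y, x = e • y ∧ g y ∈ L := by
  set n := p.natDegree with hn
  let v : ℕ → K := fun i => e ^ (n - i) • (g ^ i) u
  have hrel : (g ^ n) u + ∑ i ∈ Finset.range n, p.coeff i • v i = 0 := by
    rw [Polynomial.aeval_eq_sum_range, Polynomial.natDegree_scaleRoots, Finset.sum_range_succ,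
      Polynomial.coeff_scaleRoots_natDegree, hp.leadingCoeff, one_smul, LinearMap.add_apply,
      add_comm, LinearMap.sum_apply] at h
    rw [← h]
    congr 1
    refine Finset.sum_congr rfl fun i _ => ?_
    rw [Polynomial.coeff_scaleRoots, LinearMap.smul_apply, mul_smul]
  have hpos : 0 < n := by
    rw [Nat.pos_iff_ne_zero]
    intro h0
    rw [h0] at hrel
    exact hu (by simpa using hrel)
  refine ⟨Submodule.span ℤ (v '' (Finset.range n : Set ℕ)), ?_, ?_⟩
  · have hv : ∀ m : ℕ, e ^ m • u = 0 → u = 0 := by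
      intro m
      induction m with
      | zero => simp
      | succ m ih =>
        intro hm
        rw [pow_succ', mul_smul] at hm
        exact ih (he _ hm)
    intro hbot
    have h0 : v 0 ∈ Submodule.span ℤ (v '' (Finset.range n : Set ℕ)) :=
      Submodule.subset_span ⟨0, by simpa using hpos, rfl⟩
    rw [hbot, Submodule.mem_bot] at h0
    exact hu (hv _ h0)
  · intro x hx
    induction hx using Submodule.span_induction with
    | mem x hx =>
      obtain ⟨i, hi, rfl⟩ := hx
      have hi' : i < n := by simpa using hi
      refine ⟨e ^ (n - (i + 1)) • (g ^ i) u, ?_, ?_⟩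
      · rw [smul_smul, ← pow_succ', show n - (i + 1) + 1 = n - i by omega]
      · rw [map_smul, ← Module.End.mul_apply, ← pow_succ']
        rcases Nat.lt_or_ge (i + 1) n with hlt | hge
        · exact Submodule.subset_span ⟨i + 1, by simpa using hlt, rfl⟩
        · have hin : i + 1 = n := by omega
          rw [hin, Nat.sub_self, pow_zero, one_smul, eq_neg_of_add_eq_zero_left hrel]
          exact neg_mem (sum_mem fun j hj =>
            Submodule.smul_mem _ _ (Submodule.subset_span ⟨j, hj, rfl⟩))
    | zero => exact ⟨0, by simp, by simp⟩
    | add x y _ _ hx hy =>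
      obtain ⟨a, rfl, ha⟩ := hx
      obtain ⟨b, rfl, hb⟩ := hy
      exact ⟨a + b, (smul_add _ _ _).symm, by rw [map_add]; exact add_mem ha hb⟩
    | smul c x _ hx =>
      obtain ⟨a, rfl, ha⟩ := hx
      exact ⟨c • a, smul_comm _ _ _, by rw [map_smul]; exact Submodule.smul_mem _ _ ha⟩

/-- The two preceding facts combined, in multiplicative notation. With `g y = f (y ^ e)` the subgroup
`L` is `f`-invariant. -/
theorem exists_subgroup_stable_under_pow_to_map {K Q : Type*} [CommGroup K] [CommGroup Q]
    [Group.FG K] [Nontrivial Q] (hK : ∀ x : K, IsOfFinOrder x → x = 1)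
    (hQ : ∀ x : Q, IsOfFinOrder x → x = 1) {π : K →* Q} (hπ : Function.Surjective π)
    {g : K →* K} {fb : Q →* Q} {e : ℕ} (he : 0 < e) (h : ∀ k, π (g k) = fb (π k) ^ e) :
    ∃ L : Subgroup K, L ≠ ⊥ ∧ ∀ x ∈ L, ∃ y, x = y ^ e ∧ g y ∈ L := by
  have : Module.Finite ℤ (Additive K) := Module.Finite.iff_addGroup_fg.2 inferInstance
  have hQ' : ¬ Module.IsTorsion ℤ (Additive Q) := by
    intro ht
    obtain ⟨q, hq⟩ := exists_ne (1 : Q)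
    obtain ⟨⟨a, ha⟩, hqa⟩ := @ht (Additive.ofMul q)
    have hqa' : q ^ a = 1 := hqa
    exact hq (hQ q (isOfFinOrder_iff_zpow_eq_one.2 ⟨a, nonZeroDivisors.ne_zero ha, hqa'⟩))
  obtain ⟨p, hp, u, hu, hpu⟩ := exists_ne_zero_aeval_scaleRoots_apply_eq_zero
    (π := (MonoidHom.toAdditive π).toIntLinearMap) (g := (MonoidHom.toAdditive g).toIntLinearMap)
    (fb := (MonoidHom.toAdditive fb).toIntLinearMap) (e := (e : ℤ)) hπ hQ' (fun k => by
      rw [natCast_zsmul]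
      exact h k.toMul)
  obtain ⟨L, hL, hLs⟩ := exists_submodule_stable_under_smul_to_map (fun x hx => by
    rw [natCast_zsmul] at hx
    exact hK x.toMul (isOfFinOrder_iff_pow_eq_one.2 ⟨e, he, hx⟩)) hp hu hpu
  refine ⟨L.toAddSubgroup.toSubgroup', fun h0 => hL ?_, fun x hx => ?_⟩
  · rw [Submodule.eq_bot_iff]
    intro x hx
    have hx' : x.toMul ∈ L.toAddSubgroup.toSubgroup' := hx
    rw [h0, Subgroup.mem_bot] at hx'
    exact hx'
  · obtain ⟨y, hy, hgy⟩ := hLs (Additive.ofMul x) hx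
    rw [natCast_zsmul] at hy
    exact ⟨y.toMul, hy, hgy⟩

/-! ### The induced map on the quotient by the centre -/

theorem commutatorElement_eq_of_mk_center_eq {G : Type*} [Group G] {a b c d : G}
    (h1 : (a : G ⧸ Subgroup.center G) = c) (h2 : (b : G ⧸ Subgroup.center G) = d) :
    ⁅a, b⁆ = ⁅c, d⁆ := by
  have key : ∀ x y z : G, z ∈ Subgroup.center G → ⁅x * z, y⁆ = ⁅x, y⁆ := fun x y z hz => by
    have h : ⁅x * z, y⁆ = x * (z * y) * z⁻¹ * x⁻¹ * y⁻¹ := by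
      rw [commutatorElement_def]
      group
    rw [h, ← Subgroup.mem_center_iff.1 hz y, commutatorElement_def]
    group
  obtain ⟨z, hz, rfl⟩ : ∃ z ∈ Subgroup.center G, c = a * z :=
    ⟨a⁻¹ * c, QuotientGroup.eq.1 h1, by group⟩
  obtain ⟨w, hw, rfl⟩ : ∃ w ∈ Subgroup.center G, d = b * w :=
    ⟨b⁻¹ * d, QuotientGroup.eq.1 h2, by group⟩
  rw [key _ _ _ hz, ← commutatorElement_inv (b * w) a, key _ _ _ hw, commutatorElement_inv]

/-- An invariant subgroup `Kb = K/Z(G)` has abelian preimage `K`; if `Kb` were nontrivial, the lattice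
construction for `g k = f (k ^ e)` would give a nontrivial `f`-invariant subgroup of `K`. -/
theorem StronglySimple.quotientHom_center {G : Type*} [Group G] [Group.FG G] [Group.IsNilpotent G]
    (htf : ∀ g : G, IsOfFinOrder g → g = 1) {H : Subgroup G} (hH : H.index ≠ 0) {f : H →* G}
    (hf : StronglySimple f) (hZ : SemiInvariant f (Subgroup.center G)) :
    StronglySimple (quotientHom f (Subgroup.center G) hZ) := by
  rintro Kb ⟨hKb, hKbf⟩
  set φ := QuotientGroup.mk' (Subgroup.center G) with hφ
  set fq := quotientHom f (Subgroup.center G) hZ with hfq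
  set K := Kb.comap φ with hK
  have hfK : ∀ a : H, (a : G) ∈ K → f a ∈ K := fun a ha => by
    refine hKbf ⟨toQuotientDomain H _ a, ha, ?_⟩
    rw [hfq, quotientHom_apply]
    rfl
  have hrep : ∀ k ∈ K, ∃ a : H, (a : G) ∈ K ∧ φ a = φ k := fun k hk => by
    have h1 := hKb hk
    rw [quotientDomain_eq] at h1
    obtain ⟨a, ha, hak⟩ := h1
    refine ⟨⟨a, ha⟩, ?_, hak⟩
    change φ a ∈ Kb
    rw [hak]
    exact hk
  -- `[K, K] = [K ∩ H, K ∩ H]` is `f`-invariant, so `K` is abelian.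
  have hcomm : ∀ a b : H, (a : G) ∈ K → (b : G) ∈ K → ⁅(a : G), (b : G)⁆ = 1 := by
    set C : Subgroup H := ⁅K.subgroupOf H, K.subgroupOf H⁆ with hC
    have hCsub : (C.map H.subtype).subgroupOf H = C :=
      Subgroup.comap_map_eq_self_of_injective H.subtype_injective _
    have hCbot : C.map H.subtype = ⊥ := by
      refine hf _ ⟨Subgroup.map_subtype_le _, ?_⟩
      rw [hCsub, hC, Subgroup.map_commutator, Subgroup.commutator_le]
      rintro _ ⟨a, ha, rfl⟩ _ ⟨b, hb, rfl⟩
      obtain ⟨a', ha', haa⟩ := hrep _ (hfK a ha)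
      obtain ⟨b', hb', hbb⟩ := hrep _ (hfK b hb)
      rw [← commutatorElement_eq_of_mk_center_eq haa hbb]
      exact ⟨⁅a', b'⁆, Subgroup.commutator_mem_commutator ha' hb', rfl⟩
    intro a b ha hb
    rw [← Subgroup.mem_bot, ← hCbot]
    exact ⟨⁅a, b⁆, Subgroup.commutator_mem_commutator ha hb, rfl⟩
  have hKcomm : ∀ a ∈ K, ∀ b ∈ K, a * b = b * a := by
    intro a ha b hb
    obtain ⟨a', ha', haa⟩ := hrep a ha
    obtain ⟨b', hb', hbb⟩ := hrep b hb
    rw [← commutatorElement_eq_one_iff_mul_comm, ← commutatorElement_eq_of_mk_center_eq haa hbb]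
    exact hcomm _ _ ha' hb'
  let _ : CommGroup K := { (inferInstance : Group K) with
    mul_comm := fun a b => Subtype.ext (hKcomm a a.2 b b.2) }
  let π : K →* Kb := (φ.comp K.subtype).codRestrict Kb fun k => k.2
  have hπ : Function.Surjective π := by
    rintro ⟨q, hq⟩
    obtain ⟨x, rfl⟩ := QuotientGroup.mk'_surjective _ q
    exact ⟨⟨x, hq⟩, rfl⟩
  let _ : CommGroup Kb := { (inferInstance : Group Kb) with
    mul_comm := fun a b => by
      obtain ⟨a, rfl⟩ := hπ a
      obtain ⟨b, rfl⟩ := hπ b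
      rw [← map_mul, mul_comm, map_mul] }
  let fb : Kb →* Kb := (fq.comp (Subgroup.inclusion hKb)).codRestrict Kb fun q =>
    hKbf ⟨Subgroup.inclusion hKb q, q.2, rfl⟩
  -- This exponent moves every element of `G` into `H`, which need not be normal.
  set e := Nat.factorial H.index with he
  have hpow : ∀ x : G, x ^ e ∈ H := fun x =>
    Subgroup.pow_mem_of_index_ne_zero_of_dvd hH x fun m h1 h2 => Nat.dvd_factorial h1 h2
  let pe : K →* H := (K.subtype.comp (powMonoidHom e)).codRestrict H fun k => by
    simpa using hpow k
  let g : K →* K := (f.comp pe).codRestrict K fun k => hfK _ (k ^ e).2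
  have hg : ∀ k, π (g k) = fb (π k) ^ e := fun k => by
    apply Subtype.ext
    have h1 : toQuotientDomain H _ (pe k) = Subgroup.inclusion hKb (π k) ^ e := by
      apply Subtype.ext
      change φ ((k ^ e : K) : G) = φ k ^ e
      rw [← map_pow]
      rfl
    change ((f (pe k) : G) : G ⧸ Subgroup.center G) = fq (Subgroup.inclusion hKb (π k)) ^ e
    rw [← quotientHom_apply f _ hZ, h1, map_pow]
  by_contra hne
  have : Nontrivial Kb := (Subgroup.nontrivial_iff_ne_bot Kb).2 hne
  have : Group.FG K := (Group.fg_iff_subgroup_fg K).2 ((HasSubgroupRank.of_isNilpotent G).fg K)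
  obtain ⟨L, hL, hLs⟩ := exists_subgroup_stable_under_pow_to_map
    (fun x hx => Subtype.ext (htf x (K.subtype.isOfFinOrder hx)))
    (fun x hx => Subtype.ext
      (isOfFinOrder_quotient_center_eq_one htf x (Kb.subtype.isOfFinOrder hx)))
    hπ (Nat.factorial_pos _) hg
  refine hL ((Subgroup.map_eq_bot_iff_of_injective _ K.subtype_injective).1 (hf _ ⟨?_, ?_⟩))
  · rintro _ ⟨x, hx, rfl⟩
    obtain ⟨y, rfl, -⟩ := hLs x hx
    exact hpow y
  · rintro _ ⟨a, ⟨x, hx, hxa⟩, rfl⟩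
    obtain ⟨y, rfl, hy⟩ := hLs x hx
    have : pe y = a := Subtype.ext hxa
    rw [← this]
    exact ⟨g y, hy, rfl⟩

/-! ### The nilpotency class -/

theorem nilpotencyClass_le_cardFactors_of_stronglySimple (G : Type*) [Group G]
    [Group.IsNilpotent G] : ∀ [Group.FG G], (∀ g : G, IsOfFinOrder g → g = 1) →
    ∀ (H : Subgroup G), H.index ≠ 0 → ∀ f : H →* G, StronglySimple f →
      Group.nilpotencyClass G ≤ ArithmeticFunction.cardFactors H.index := by
  refine Group.nilpotent_center_quotient_ind (P := fun G _ _ => ∀ [Group.FG G],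
    (∀ g : G, IsOfFinOrder g → g = 1) → ∀ (H : Subgroup G), H.index ≠ 0 → ∀ f : H →* G,
    StronglySimple f → Group.nilpotencyClass G ≤ ArithmeticFunction.cardFactors H.index) G ?_ ?_
  · intro G _ _ _ _ H _ f _
    rw [Group.nilpotencyClass_zero_iff_subsingleton.2 inferInstance]
    exact Nat.zero_le _
  · intro G _ _ ih _ htf H hH f hf
    rcases subsingleton_or_nontrivial G with hG | hG
    · rw [Group.nilpotencyClass_zero_iff_subsingleton.2 hG]
      exact Nat.zero_le _
    have hZ := semiInvariant_center_of_injective htf hH hf.injective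
    -- Otherwise the centre would be a nontrivial `f`-invariant subgroup.
    have hnot : ¬ H ⊔ Subgroup.center G ≤ H := fun hle =>
      Group.IsNilpotent.center_ne_bot G (hf _ ⟨le_sup_right.trans hle, hZ⟩)
    have hmul := Subgroup.relIndex_mul_index (le_sup_left : H ≤ H ⊔ Subgroup.center G)
    have hidx : (quotientDomain H (Subgroup.center G)).index = (H ⊔ Subgroup.center G).index :=
      Subgroup.index_map_eq _ (QuotientGroup.mk'_surjective _) (by
        rw [QuotientGroup.ker_mk']
        exact le_sup_right)
    have h1 : H.relIndex (H ⊔ Subgroup.center G) ≠ 0 := left_ne_zero_of_mul (hmul ▸ hH)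
    have h2 : (H ⊔ Subgroup.center G).index ≠ 0 := right_ne_zero_of_mul (hmul ▸ hH)
    have h3 := ih (isOfFinOrder_quotient_center_eq_one htf) _ (hidx ▸ h2) _
      (hf.quotientHom_center htf hH hZ)
    have h4 : 0 < ArithmeticFunction.cardFactors (H.relIndex (H ⊔ Subgroup.center G)) := by
      rw [ArithmeticFunction.cardFactors_pos_iff_one_lt]
      have : H.relIndex (H ⊔ Subgroup.center G) ≠ 1 := fun h => hnot (Subgroup.relIndex_eq_one.1 h)
      omega
    rw [Group.nilpotencyClass_eq_quotient_center_plus_one, ← hmul,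
      ArithmeticFunction.cardFactors_mul h1 h2, ← hidx]
    omega

theorem mainTheorem3 {G : Type*} [Group G] [Group.FG G] [Group.IsNilpotent G]
    (htf : ∀ g : G, IsOfFinOrder g → g = 1)
    (H : Subgroup G) (m : ℕ) (hm : 0 < m) (hH : H.index = m)
    (f : H →* G) (hf : StronglySimple f) :
    (∃ hZ : SemiInvariant f (Subgroup.center G),
      StronglySimple (quotientHom f (Subgroup.center G) hZ)) ∧
    Group.nilpotencyClass G ≤ ArithmeticFunction.cardFactors m := by
  subst hH
  have hZ := semiInvariant_center_of_injective htf hm.ne' hf.injective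
  exact ⟨⟨hZ, hf.quotientHom_center htf hm.ne' hZ⟩,
    nilpotencyClass_le_cardFactors_of_stronglySimple G htf H hm.ne' f hf⟩
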